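/- Let $n\ge 0$ be an integer, let $p<q$ be real numbers and let $f\in C^{2n+1}[p,q]$. Then there is a constant $C$, depending only on $n,p,q$ and $f$, such that the following holds. Let $x_0,x_1,\dots,x_n$ and $x$ be $n+2$ pairwise distinct points of $[p,q]$, and put $$L_i(x)=\prod_{\substack{j=0\\ j\ne i}}^n\frac{x-x_j}{x_i-x_j}\quad(0\le i\le n),\qquad \rho_k=\sum_{i=0}^n\frac{L_i(x)}{(x_i-x)^k}\quad(k\ge 0),$$ $$a_0=1,\qquad a_k=-(\rho_k a_0+\rho_{k-1}a_1+\dots+\rho_1a_{k-1})\quad(1\le k\le n),$$ and, for real $h$, $$\gamma_k=\gamma_k(h)=\frac{h^{k+1}}{k+1}+a_1\frac{h^{k+2}}{k+2}+\dots+a_{n-k}\frac{h^{n+1}}{n+1}\quad(0\le k\le n).$$ Then there are points $\xi_0,\dots,\xi_n$, independent of $h$, each lying strictly between the smallest and the largest of the numbers $x,x_0,\dots,x_n$, such that for every $h\ne0$ with $x+h\in[p,q]$ $$\int_x^{x+h}f(t)\,dt=\sum_{i=0}^n f(x_i)L_i(x)\left(\gamma_0+\frac{\gamma_1}{x_i-x}+\dots+\frac{\gamma_n}{(x_i-x)^n}\right)+\prod_{i=0}^n(x-x_i)\left(\frac{f^{(n+1)}(\xi_n)}{(n+1)!}\gamma_0+\frac{f^{(n+2)}(\xi_{n-1})}{(n+2)!}\gamma_1+\dots+\frac{f^{(2n+1)}(\xi_0)}{(2n+1)!}\gamma_n\right)+R(h),$$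 where $|R(h)|\le C|h|^{n+2}$; in particular $R(h)=O(h^{n+2})$ as $h\to0$. -/

import Mathlib

open Finset

namespace NodeQuadrature

/-- The Lagrange coefficient `L_i(x) = ∏_{j ≠ i} (x - u_j) / (u_i - u_j)` of the nodes
`u_0, …, u_n`. -/
noncomputable def L {n : ℕ} (u : Fin (n + 1) → ℝ) (x : ℝ) (i : Fin (n + 1)) : ℝ :=
  ∏ j ∈ univ.erase i, (x - u j) / (u i - u j)

/-- `L` is the value at `x` of Mathlib's Lagrange basis polynomial. -/
theorem L_eq_eval_basis {n : ℕ} (u : Fin (n + 1) → ℝ) (x : ℝ) (i : Fin (n + 1)) :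
    L u x i = (Lagrange.basis univ u i).eval x := by
  simp only [L, Lagrange.basis, Lagrange.basisDivisor, Polynomial.eval_prod, Polynomial.eval_mul,
    Polynomial.eval_C, Polynomial.eval_sub, Polynomial.eval_X]
  exact prod_congr rfl fun j _ => by rw [div_eq_mul_inv, mul_comm]

/-- `ρ_k = ∑_i L_i(x) / (u_i - x)^k`. -/
noncomputable def rho {n : ℕ} (u : Fin (n + 1) → ℝ) (x : ℝ) (k : ℕ) : ℝ :=
  ∑ i, L u x i / (u i - x) ^ k

/-- `a_0 = 1` and `a_k = -(ρ_k a_0 + ρ_{k-1} a_1 + … + ρ_1 a_{k-1})` for `k ≥ 1`. -/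
noncomputable def a {n : ℕ} (u : Fin (n + 1) → ℝ) (x : ℝ) : ℕ → ℝ
  | 0 => 1
  | k + 1 => -∑ j : Fin (k + 1), rho u x (k + 1 - j) * a u x j
decreasing_by exact j.isLt

/-- The recursion for `a`, as a sum over natural numbers. -/
theorem a_succ {n : ℕ} (u : Fin (n + 1) → ℝ) (x : ℝ) (k : ℕ) :
    a u x (k + 1) = -∑ j ∈ range (k + 1), rho u x (k + 1 - j) * a u x j := by
  rw [a, ← Fin.sum_univ_eq_sum_range (fun j => rho u x (k + 1 - j) * a u x j)]

/-- `γ_k = h^{k+1}/(k+1) + a_1 h^{k+2}/(k+2) + … + a_{n-k} h^{n+1}/(n+1)`, for `k ≤ n`. -/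
noncomputable def gam {n : ℕ} (u : Fin (n + 1) → ℝ) (x h : ℝ) (k : ℕ) : ℝ :=
  ∑ m ∈ range (n - k + 1), a u x m * (h ^ (k + m + 1) / ((k + m + 1 : ℕ) : ℝ))

end NodeQuadrature

/-! Up to `O(h^{n+2})` the integral is `∑ c_k h^{k+1}/(k+1)`, with `c_k` the Taylor coefficients of
`f` at `x` (`exists_taylor_integral_bound`). It remains to express the `c_k` through the values at
the nodes. The divided difference of `f` on the nodes and `x` taken `k + 1` times equals
`f^{(n+1+k)}(ξ)/(n+1+k)!`, by Rolle applied to `f` minus its Hermite interpolant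
(`exists_iteratedDerivWithin_eq`). Written out, this says that `ρ` convolved with `c` is an explicit
sequence `b`. Since `∑ a_k X^k` is the reciprocal of `∑ ρ_k X^k`, `c` is the convolution of `a` and
`b`, and regrouping by `b_k` produces `γ_k` (`sum_mul_gam`). -/

/-! ### Rolle's theorem and a mean value estimate -/

/-- Rolle in the gaps between consecutive elements of `Z`. Disjointness from `Z` allows a multiple
zero lying in `Z` to be adjoined again as an extra zero of the derivative. -/
theorem exists_zeros_of_deriv {a b : ℝ} {g g' : ℝ → ℝ}
    (hg : ∀ t ∈ Set.Icc a b, HasDerivWithinAt g (g' t) (Set.Icc a b) t)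
    {m : ℕ} {Z : Finset ℝ} (hcard : Z.card = m + 1) (hZ : ∀ z ∈ Z, z ∈ Set.Icc a b ∧ g z = 0) :
    ∃ S : Finset ℝ, S.card = m ∧ Disjoint S Z ∧ ∀ z ∈ S, z ∈ Set.Ioo a b ∧ g' z = 0 := by
  set e := Z.orderEmbOfFin hcard with he
  have hmem : ∀ i, e i ∈ Z := fun i => Z.orderEmbOfFin_mem hcard i
  have hex : ∀ i : Fin m, ∃ w ∈ Set.Ioo (e i.castSucc) (e i.succ), g' w = 0 := by
    intro i
    have hlt : e i.castSucc < e i.succ := e.strictMono Fin.castSucc_lt_succ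
    obtain ⟨h1, h1'⟩ := hZ _ (hmem i.castSucc)
    obtain ⟨h2, h2'⟩ := hZ _ (hmem i.succ)
    have hsub : Set.Icc (e i.castSucc) (e i.succ) ⊆ Set.Icc a b := Set.Icc_subset_Icc h1.1 h2.2
    refine exists_hasDerivAt_eq_zero hlt
      (fun t ht => ((hg t (hsub ht)).continuousWithinAt).mono hsub) (h1'.trans h2'.symm) ?_
    intro t ht
    exact (hg t (hsub (Set.Ioo_subset_Icc_self ht))).hasDerivAt
      (Icc_mem_nhds (h1.1.trans_lt ht.1) (ht.2.trans_le h2.2))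
  choose w hw hw0 using hex
  have hmono : StrictMono w := by
    intro i j hij
    refine (hw i).2.trans_le (le_trans (e.monotone ?_) (hw j).1.le)
    exact Fin.succ_le_castSucc_iff.2 hij
  refine ⟨univ.map ⟨w, hmono.injective⟩, by simp, ?_, ?_⟩
  · rw [Finset.disjoint_left]
    intro z hz hzZ
    obtain ⟨i, -, rfl⟩ := Finset.mem_map.1 hz
    have : w i ∈ Set.range e := by rw [he, Finset.range_orderEmbOfFin]; exact hzZ
    obtain ⟨j, hj⟩ := this
    have h1 : e i.castSucc < e j := by rw [hj]; exact (hw i).1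
    have h2 : e j < e i.succ := by rw [hj]; exact (hw i).2
    rw [e.lt_iff_lt] at h1 h2
    simp only [Fin.lt_def, Fin.val_castSucc, Fin.val_succ] at h1 h2
    omega
  · intro z hz
    obtain ⟨i, -, rfl⟩ := Finset.mem_map.1 hz
    exact ⟨⟨(hZ _ (hmem _)).1.1.trans_lt (hw i).1, (hw i).2.trans_le (hZ _ (hmem _)).1.2⟩, hw0 i⟩

theorem exists_zero_of_many_zeros {a b : ℝ} (m : ℕ) : ∀ {G : ℕ → ℝ → ℝ} {Z : Finset ℝ},
    (∀ j ≤ m, ∀ t ∈ Set.Icc a b, HasDerivWithinAt (G j) (G (j + 1) t) (Set.Icc a b) t) →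
    Z.card = m + 2 → (∀ z ∈ Z, z ∈ Set.Icc a b ∧ G 0 z = 0) →
    ∃ ξ ∈ Set.Ioo a b, G (m + 1) ξ = 0 := by
  induction m with
  | zero =>
    intro G Z hG hcard hZ
    obtain ⟨S, hS, -, h⟩ := exists_zeros_of_deriv (hG 0 le_rfl) hcard hZ
    obtain ⟨z, rfl⟩ := Finset.card_eq_one.1 hS
    exact ⟨z, h z (by simp)⟩
  | succ m ih =>
    intro G Z hG hcard hZ
    obtain ⟨S, hS, -, h⟩ := exists_zeros_of_deriv (hG 0 (Nat.zero_le _)) hcard hZ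
    exact ih (G := fun j => G (j + 1)) (fun j hj => hG (j + 1) (by omega)) hS
      fun z hz => ⟨Set.Ioo_subset_Icc_self (h z hz).1, (h z hz).2⟩

/-- Rolle's theorem for `m + 1` simple zeros and one zero of multiplicity `k + 1`. -/
theorem exists_zero_of_multiple_zero {a b x : ℝ} (hx : x ∈ Set.Icc a b) {m : ℕ} (k : ℕ) :
    ∀ {G : ℕ → ℝ → ℝ} {Z : Finset ℝ},
    (∀ j ≤ m + k, ∀ t ∈ Set.Icc a b, HasDerivWithinAt (G j) (G (j + 1) t) (Set.Icc a b) t) →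
    Z.card = m + 1 → x ∉ Z → (∀ z ∈ Z, z ∈ Set.Icc a b ∧ G 0 z = 0) → (∀ j ≤ k, G j x = 0) →
    ∃ ξ ∈ Set.Ioo a b, G (m + k + 1) ξ = 0 := by
  induction k with
  | zero =>
    intro G Z hG hcard hxZ hZ h0
    refine exists_zero_of_many_zeros m hG (Z := insert x Z)
      (by rw [Finset.card_insert_of_notMem hxZ, hcard]) ?_
    intro z hz
    rcases Finset.mem_insert.1 hz with rfl | hz
    · exact ⟨hx, h0 0 le_rfl⟩
    · exact hZ z hz
  | succ k ih =>
    intro G Z hG hcard hxZ hZ h0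
    have hZ' : ∀ z ∈ insert x Z, z ∈ Set.Icc a b ∧ G 0 z = 0 := by
      intro z hz
      rcases Finset.mem_insert.1 hz with rfl | hz
      · exact ⟨hx, h0 0 (Nat.zero_le _)⟩
      · exact hZ z hz
    obtain ⟨S, hS, hd, h⟩ := exists_zeros_of_deriv (m := m + 1) (hG 0 (Nat.zero_le _))
      (by rw [Finset.card_insert_of_notMem hxZ, hcard]) hZ'
    exact ih (G := fun j => G (j + 1)) (fun j hj => hG (j + 1) (by omega)) hS
      (fun hxS => Finset.disjoint_left.1 hd hxS (Finset.mem_insert_self _ _))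
      (fun z hz => ⟨Set.Ioo_subset_Icc_self (h z hz).1, (h z hz).2⟩)
      (fun j hj => h0 (j + 1) (by omega))

/-- The mean value inequality on the segment from `x` to `t`, iterated `m` times. The factor `1 /
m!` is given up, as only some constant is needed. -/
theorem abs_le_of_iterated_deriv_bound {s : Set ℝ} (hs : Convex ℝ s) {x M : ℝ} (hx : x ∈ s) (m : ℕ) :
    ∀ {G : ℕ → ℝ → ℝ},
    (∀ j < m, ∀ t ∈ s, HasDerivWithinAt (G j) (G (j + 1) t) s t) →
    (∀ j < m, G j x = 0) → (∀ t ∈ s, |G m t| ≤ M) → ∀ t ∈ s, |G 0 t| ≤ M * |t - x| ^ m := by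
  induction m with
  | zero => intro G _ _ hM t ht; simpa using hM t ht
  | succ m ih =>
    intro G hG h0 hM t ht
    have hM0 : 0 ≤ M := (abs_nonneg _).trans (hM x hx)
    have key := ih (G := fun j => G (j + 1)) (fun j hj => hG (j + 1) (by omega))
      (fun j hj => h0 (j + 1) (by omega)) hM
    have hsub : Set.uIcc x t ⊆ s := by
      rw [← segment_eq_uIcc]; exact hs.segment_subset hx ht
    have := (convex_uIcc x t).norm_image_sub_le_of_norm_hasDerivWithin_le
      (f := G 0) (f' := G 1) (C := M * |t - x| ^ m)
      (fun y hy => (hG 0 (Nat.succ_pos _) y (hsub hy)).mono hsub)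
      (fun y hy => (key y (hsub hy)).trans (by
        have := Set.abs_sub_left_of_mem_uIcc hy
        gcongr)) Set.left_mem_uIcc Set.right_mem_uIcc
    rw [h0 0 (Nat.succ_pos _), sub_zero, Real.norm_eq_abs, Real.norm_eq_abs] at this
    rw [pow_succ, ← mul_assoc]; exact this

/-! ### Hermite interpolation and confluent divided differences -/

namespace Polynomial

theorem eval_iterate_derivative_eq_coeff_taylor (P : ℝ[X]) (r : ℝ) (j : ℕ) :
    (derivative^[j] P).eval r = (j.factorial : ℝ) * (taylor r P).coeff j := by
  rw [taylor_coeff, ← factorial_smul_hasseDeriv, LinearMap.smul_apply, eval_smul, nsmul_eq_mul]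

theorem coeff_taylor_of_natDegree_le {P : ℝ[X]} {N : ℕ} (h : P.natDegree ≤ N) (r : ℝ) :
    (taylor r P).coeff N = P.coeff N := by
  rcases h.lt_or_eq with h | rfl
  · rw [coeff_eq_zero_of_natDegree_lt h, coeff_eq_zero_of_natDegree_lt (by rwa [natDegree_taylor])]
  · rw [coeff_taylor_natDegree, leadingCoeff]

end Polynomial

namespace NodeQuadrature

open Polynomial

/-- The `j`-th Taylor coefficient of `f` at `x`, with derivatives taken within `s`. -/
noncomputable def taylorCoeff (f : ℝ → ℝ) (s : Set ℝ) (x : ℝ) (j : ℕ) : ℝ :=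
  iteratedDerivWithin j f s x / (j.factorial : ℝ)

theorem hasDerivWithinAt_iteratedDerivWithin_sub_eval {p q : ℝ} (hpq : p < q) {f : ℝ → ℝ} {N : ℕ}
    (hf : ContDiffOn ℝ (N : WithTop ℕ∞) f (Set.Icc p q)) (P : ℝ[X]) {j : ℕ} (hj : j < N)
    {t : ℝ} (ht : t ∈ Set.Icc p q) :
    HasDerivWithinAt
      (fun t => iteratedDerivWithin j f (Set.Icc p q) t - (derivative^[j] P).eval t)
      (iteratedDerivWithin (j + 1) f (Set.Icc p q) t - (derivative^[j + 1] P).eval t)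
      (Set.Icc p q) t := by
  rw [iteratedDerivWithin_succ, Function.iterate_succ_apply']
  exact ((hf.differentiableOn_iteratedDerivWithin (mod_cast hj) (uniqueDiffOn_Icc hpq)
    t ht).hasDerivWithinAt).sub (Polynomial.hasDerivWithinAt _ _ _)

/-- The Taylor polynomial of degree `k` at `0` with coefficients `c`. -/
noncomputable def truncPoly (c : ℕ → ℝ) (k : ℕ) : ℝ[X] := ∑ i ∈ range (k + 1), monomial i (c i)

theorem coeff_truncPoly (c : ℕ → ℝ) {k j : ℕ} (hj : j ≤ k) : (truncPoly c k).coeff j = c j := by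
  simp [truncPoly, finsetSum_coeff, coeff_monomial, Nat.lt_succ_of_le hj]

theorem natDegree_truncPoly_le (c : ℕ → ℝ) (k : ℕ) : (truncPoly c k).natDegree ≤ k :=
  natDegree_sum_le_of_forall_le _ _ fun _ hi =>
    (natDegree_monomial_le _).trans (Nat.lt_succ_iff.1 (mem_range.1 hi))

theorem eval_truncPoly (c : ℕ → ℝ) (k : ℕ) (t : ℝ) :
    (truncPoly c k).eval t = ∑ i ∈ range (k + 1), c i * t ^ i := by
  simp [truncPoly, eval_finsetSum]

theorem L_eq_prod_div {n : ℕ} (u : Fin (n + 1) → ℝ) (x : ℝ) (hx : ∀ i, x ≠ u i) (i : Fin (n + 1)) :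
    L u x i = (∏ j, (x - u j)) / ((x - u i) * ∏ j ∈ univ.erase i, (u i - u j)) := by
  rw [L, prod_div_distrib, ← mul_prod_erase univ (fun j => x - u j) (mem_univ i),
    mul_div_mul_left _ _ (sub_ne_zero.2 (hx i))]

/-- The confluent divided difference with the point `x` repeated `k + 1` times equals a value of
the derivative of order `n + 1 + k`. -/
theorem exists_iteratedDerivWithin_eq {n k N : ℕ} {p q : ℝ} (hpq : p < q) {f : ℝ → ℝ}
    (hf : ContDiffOn ℝ (N : WithTop ℕ∞) f (Set.Icc p q)) (hN : n + 1 + k ≤ N)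
    {u : Fin (n + 1) → ℝ} {x : ℝ} (hinj : Function.Injective u)
    (hu : ∀ i, u i ∈ Set.Icc p q) (hxI : x ∈ Set.Icc p q) (hx : ∀ i, x ≠ u i) :
    ∃ ξ : ℝ, ((∃ y ∈ insert x (Set.range u), y < ξ) ∧ (∃ z ∈ insert x (Set.range u), ξ < z)) ∧
      ∑ i, L u x i * (f (u i) - ∑ j ∈ range (k + 1),
        taylorCoeff f (Set.Icc p q) x j * (u i - x) ^ j) / (u i - x) ^ k +
      (∏ i, (x - u i)) * taylorCoeff f (Set.Icc p q) ξ (n + 1 + k) = 0 := by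
  set c := taylorCoeff f (Set.Icc p q) x with hc
  set F : Fin (n + 1) → ℝ := fun i =>
    (f (u i) - ∑ j ∈ range (k + 1), c j * (u i - x) ^ j) / (u i - x) ^ (k + 1) with hF
  set R := Lagrange.interpolate univ u F with hR
  -- `S` is the Hermite interpolant in the variable `t - x`, so `P(t) = S(t - x)`: the Taylor part
  -- fixes the derivatives up to order `k` at `x`, and `R` corrects the values at the nodes.
  set S := truncPoly c k + taylor x R * X ^ (k + 1) with hS
  set P := taylor (-x) S with hP
  have hinj' : Set.InjOn u (univ : Finset (Fin (n + 1))) := hinj.injOn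
  have hRdeg : R.degree < ((n + 1 : ℕ) : WithBot ℕ) := by
    have := Lagrange.degree_interpolate_lt F hinj'
    rwa [card_univ, Fintype.card_fin] at this
  have hRnat : R.natDegree ≤ n := by
    rcases eq_or_ne R 0 with h | h
    · simp [h]
    · exact Nat.lt_succ_iff.1 ((natDegree_lt_iff_degree_lt h).2 hRdeg)
  have hRcoeff : R.coeff n = ∑ i, F i / ∏ j ∈ univ.erase i, (u i - u j) := by
    have := Lagrange.coeff_eq_sum hinj' (P := R) (by simpa using hRdeg)
    rw [card_univ, Fintype.card_fin, Nat.add_sub_cancel] at this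
    rw [this]
    exact sum_congr rfl fun i hi => by rw [hR, Lagrange.eval_interpolate_at_node F hinj' hi]
  have hSdeg : S.natDegree ≤ n + 1 + k := by
    refine natDegree_add_le_of_degree_le ((natDegree_truncPoly_le c k).trans (by omega)) ?_
    refine natDegree_mul_le.trans ?_
    rw [natDegree_taylor, natDegree_X_pow]
    omega
  have hScoeff : S.coeff (n + 1 + k) = R.coeff n := by
    rw [hS, coeff_add, coeff_eq_zero_of_natDegree_lt
      ((natDegree_truncPoly_le c k).trans_lt (by omega)), zero_add,
      show n + 1 + k = n + (k + 1) by omega, coeff_mul_X_pow, coeff_taylor_of_natDegree_le hRnat]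
  have hPtop : ∀ ξ, (derivative^[n + 1 + k] P).eval ξ =
      ((n + 1 + k).factorial : ℝ) * R.coeff n := by
    intro ξ
    rw [eval_iterate_derivative_eq_coeff_taylor, hP, taylor_taylor,
      coeff_taylor_of_natDegree_le hSdeg, hScoeff]
  have hPx : ∀ j ≤ k, (derivative^[j] P).eval x = iteratedDerivWithin j f (Set.Icc p q) x := by
    intro j hj
    rw [eval_iterate_derivative_eq_coeff_taylor, hP, taylor_taylor, add_neg_cancel, taylor_zero,
      hS, coeff_add, coeff_truncPoly c hj, coeff_mul_X_pow', if_neg (by omega), add_zero, hc,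
      taylorCoeff, mul_div_cancel₀ _ (by positivity)]
  have hPu : ∀ i, P.eval (u i) = f (u i) := by
    intro i
    have : u i - x ≠ 0 := sub_ne_zero.2 (hx i).symm
    rw [hP, taylor_eval, ← sub_eq_add_neg, hS, eval_add, eval_truncPoly, eval_mul, taylor_eval,
      sub_add_cancel, eval_pow, eval_X, hR, Lagrange.eval_interpolate_at_node F hinj' (mem_univ i),
      hF]
    field_simp
    ring
  have hxZ : x ∉ univ.image u := by simpa using fun i => (hx i).symm
  -- Rolle is applied on the hull of `T` rather than on `[p, q]`, which places `ξ` strictly between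
  -- the extreme points.
  set T := insert x (univ.image u) with hT
  have hTne : T.Nonempty := insert_nonempty _ _
  have hTmem : ∀ y, y ∈ T ↔ y ∈ insert x (Set.range u) := by simp [hT]
  have hTI : ∀ y ∈ T, y ∈ Set.Icc p q := by
    intro y hy
    rcases (hTmem y).1 hy with rfl | ⟨i, rfl⟩
    exacts [hxI, hu i]
  have hsub : Set.Icc (T.min' hTne) (T.max' hTne) ⊆ Set.Icc p q :=
    Set.Icc_subset_Icc (hTI _ (T.min'_mem hTne)).1 (hTI _ (T.max'_mem hTne)).2
  have hTIcc : ∀ y ∈ T, y ∈ Set.Icc (T.min' hTne) (T.max' hTne) := fun y hy =>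
    ⟨T.min'_le y hy, T.le_max' y hy⟩
  obtain ⟨ξ, hξ, hξ0⟩ := exists_zero_of_multiple_zero (hTIcc x (mem_insert_self _ _)) (m := n) k
    (G := fun j t => iteratedDerivWithin j f (Set.Icc p q) t - (derivative^[j] P).eval t)
    (Z := univ.image u)
    (fun j hj t ht => (hasDerivWithinAt_iteratedDerivWithin_sub_eval hpq hf P (by omega)
      (hsub ht)).mono hsub)
    (by rw [card_image_of_injective _ hinj, card_univ, Fintype.card_fin]) hxZ
    (by
      intro z hz
      refine ⟨hTIcc z (mem_insert_of_mem hz), ?_⟩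
      obtain ⟨i, -, rfl⟩ := mem_image.1 hz
      simp [hPu])
    (fun j hj => by simp [hPx j hj])
  refine ⟨ξ, ⟨⟨_, (hTmem _).1 (T.min'_mem hTne), hξ.1⟩, ⟨_, (hTmem _).1 (T.max'_mem hTne), hξ.2⟩⟩, ?_⟩
  have htc : taylorCoeff f (Set.Icc p q) ξ (n + 1 + k) = R.coeff n := by
    rw [show n + k + 1 = n + 1 + k by omega, hPtop, sub_eq_zero] at hξ0
    rw [taylorCoeff, hξ0, mul_div_cancel_left₀ _ (by positivity)]
  -- The sum cancels term by term; the sign comes from the factor `x - u i = -(u i - x)` missing in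
  -- `L u x i`.
  rw [htc, hRcoeff, mul_sum, ← sum_add_distrib]
  refine sum_eq_zero fun i _ => ?_
  have h1 : u i - x ≠ 0 := sub_ne_zero.2 (hx i).symm
  have h2 : ∏ j ∈ univ.erase i, (u i - u j) ≠ 0 :=
    prod_ne_zero_iff.2 fun j hj => sub_ne_zero.2 (hinj.ne (ne_of_mem_erase hj).symm)
  rw [L_eq_prod_div u x hx, hF, ← neg_sub (u i) x]
  field_simp
  ring

/-! ### Inverting the convolution with `ρ` -/

theorem rho_zero {n : ℕ} {u : Fin (n + 1) → ℝ} (hinj : Function.Injective u) (x : ℝ) :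
    rho u x 0 = 1 := by
  have := congrArg (eval x) (Lagrange.sum_basis (s := univ) (v := u) hinj.injOn univ_nonempty)
  rw [eval_finsetSum, eval_one] at this
  simpa [rho, L_eq_eval_basis] using this

/-- Because `ρ_0 = 1`, the recursion defining `a` is exactly the vanishing of the higher
coefficients of the product. -/
theorem mk_a_mul_mk_rho {n : ℕ} {u : Fin (n + 1) → ℝ} (hinj : Function.Injective u) (x : ℝ) :
    PowerSeries.mk (a u x) * PowerSeries.mk (rho u x) = 1 := by
  ext k
  rw [PowerSeries.coeff_mul, Nat.sum_antidiagonal_eq_sum_range_succ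
    (fun i j => PowerSeries.coeff i (PowerSeries.mk (a u x)) *
      PowerSeries.coeff j (PowerSeries.mk (rho u x)))]
  simp only [PowerSeries.coeff_mk, PowerSeries.coeff_one]
  cases k with
  | zero => simp [rho_zero hinj, a]
  | succ k =>
    rw [sum_range_succ, Nat.sub_self, rho_zero hinj, mul_one, a_succ, if_neg (Nat.succ_ne_zero k),
      add_neg_eq_zero]
    exact sum_congr rfl fun j _ => mul_comm _ _

/-- If `b` is the convolution of `ρ` and `c`, the sum of `c_k h^{k+1}/(k+1)` is that of
`b_k γ_k`. -/
theorem sum_mul_gam {n : ℕ} {u : Fin (n + 1) → ℝ} (hinj : Function.Injective u) (x h : ℝ)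
    {b c : ℕ → ℝ} (hbc : ∀ k ≤ n, b k = ∑ j ∈ range (k + 1), c j * rho u x (k - j)) :
    ∑ k ∈ range (n + 1), c k * (h ^ (k + 1) / ((k + 1 : ℕ) : ℝ)) =
      ∑ k ∈ range (n + 1), b k * gam u x h k := by
  -- The relation `hbc` is known only up to `n`, so the power series identity is formed with `c * ρ`
  -- itself and `b` is substituted coefficientwise.
  have hc : ∀ k ≤ n, c k = ∑ j ∈ range (k + 1), b j * a u x (k - j) := by
    intro k hk
    have key : PowerSeries.mk c * PowerSeries.mk (rho u x) * PowerSeries.mk (a u x) =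
        PowerSeries.mk c := by
      rw [mul_assoc, mul_comm (PowerSeries.mk (rho u x)), mk_a_mul_mk_rho hinj, mul_one]
    have hk' := congrArg (PowerSeries.coeff k) key
    rw [PowerSeries.coeff_mul, Nat.sum_antidiagonal_eq_sum_range_succ
      (fun i j => PowerSeries.coeff i (PowerSeries.mk c * PowerSeries.mk (rho u x)) *
        PowerSeries.coeff j (PowerSeries.mk (a u x)))] at hk'
    simp only [PowerSeries.coeff_mk] at hk'
    rw [← hk']
    refine sum_congr rfl fun j hj => ?_
    rw [hbc j (by have := mem_range.1 hj; omega), PowerSeries.coeff_mul,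
      Nat.sum_antidiagonal_eq_sum_range_succ
      (fun i j => PowerSeries.coeff i (PowerSeries.mk c) *
        PowerSeries.coeff j (PowerSeries.mk (rho u x)))]
    simp only [PowerSeries.coeff_mk]
  have hflip := sum_range_diag_flip (n + 1)
    (fun k m => b k * (a u x m * (h ^ (k + m + 1) / ((k + m + 1 : ℕ) : ℝ))))
  calc _ = _ := sum_congr rfl fun k hk => ?_
    _ = _ := hflip
    _ = _ := sum_congr rfl fun k hk => ?_
  · rw [hc k (Nat.lt_succ_iff.1 (mem_range.1 hk)), sum_mul]
    refine sum_congr rfl fun j hj => ?_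
    rw [Nat.add_sub_cancel' (Nat.lt_succ_iff.1 (mem_range.1 hj)), mul_assoc]
  · rw [gam, mul_sum, Nat.sub_add_comm (Nat.lt_succ_iff.1 (mem_range.1 hk))]

/-! ### Integrating the Taylor polynomial, and conclusion -/

theorem exists_taylor_integral_bound {n : ℕ} {p q : ℝ} (hpq : p < q) {f : ℝ → ℝ}
    (hf : ContDiffOn ℝ ((n + 1 : ℕ) : WithTop ℕ∞) f (Set.Icc p q)) :
    ∃ C : ℝ, ∀ x ∈ Set.Icc p q, ∀ h : ℝ, x + h ∈ Set.Icc p q →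
      |(∫ t in x..(x + h), f t) - ∑ k ∈ range (n + 1),
        taylorCoeff f (Set.Icc p q) x k * (h ^ (k + 1) / ((k + 1 : ℕ) : ℝ))| ≤ C * |h| ^ (n + 2) := by
  -- The constant bounds the derivative of order `n + 1` on all of `[p, q]`, hence does not depend
  -- on `x` or on any nodes.
  obtain ⟨M, hM⟩ := isCompact_Icc.exists_bound_of_continuousOn
    (hf.continuousOn_iteratedDerivWithin le_rfl (uniqueDiffOn_Icc hpq))
  refine ⟨M, fun x hx h hxh => ?_⟩
  have hM0 : 0 ≤ M := (norm_nonneg _).trans (hM x hx)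
  set c := taylorCoeff f (Set.Icc p q) x with hc
  set P := taylor (-x) (truncPoly c n) with hP
  have hPeval : ∀ t, P.eval t = ∑ k ∈ range (n + 1), c k * (t - x) ^ k := fun t => by
    rw [hP, taylor_eval, ← sub_eq_add_neg, eval_truncPoly]
  have hPdeg : derivative^[n + 1] P = 0 := iterate_derivative_eq_zero <| by
    rw [hP, natDegree_taylor]
    exact Nat.lt_succ_of_le (natDegree_truncPoly_le c n)
  have hbound := abs_le_of_iterated_deriv_bound (convex_Icc p q) (M := M) hx (n + 1)
    (G := fun j t => iteratedDerivWithin j f (Set.Icc p q) t - (derivative^[j] P).eval t)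
    (fun j hj t ht => hasDerivWithinAt_iteratedDerivWithin_sub_eval hpq hf P hj ht)
    (fun j hj => by
      rw [eval_iterate_derivative_eq_coeff_taylor, hP, taylor_taylor, add_neg_cancel, taylor_zero,
        coeff_truncPoly c (Nat.lt_succ_iff.1 hj), hc, taylorCoeff,
        mul_div_cancel₀ _ (by positivity), sub_self])
    (fun t ht => by simpa [hPdeg] using hM t ht)
  simp only [iteratedDerivWithin_zero, Function.iterate_zero, id] at hbound
  have hsub : Set.uIcc x (x + h) ⊆ Set.Icc p q := Set.uIcc_subset_Icc hx hxh
  have hfint : IntervalIntegrable f MeasureTheory.volume x (x + h) :=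
    (hf.continuousOn.mono hsub).intervalIntegrable
  have hPint : ∫ t in x..(x + h), P.eval t =
      ∑ k ∈ range (n + 1), c k * (h ^ (k + 1) / ((k + 1 : ℕ) : ℝ)) := by
    simp only [hPeval]
    rw [intervalIntegral.integral_finsetSum
      (fun i _ => (by fun_prop : Continuous fun t : ℝ => c i * (t - x) ^ i).intervalIntegrable _ _)]
    refine sum_congr rfl fun k _ => ?_
    rw [intervalIntegral.integral_const_mul,
      intervalIntegral.integral_comp_sub_right (fun t => t ^ k), integral_pow]
    simp
  rw [← hPint, ← intervalIntegral.integral_sub hfint (P.continuous.intervalIntegrable _ _)]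
  have := intervalIntegral.norm_integral_le_of_norm_le_const (a := x) (b := x + h)
    (f := fun t => f t - P.eval t) (C := M * |h| ^ (n + 1)) (fun t ht => by
      have ht' := Set.uIoc_subset_uIcc ht
      refine (hbound t (hsub ht')).trans ?_
      have h1 := Set.abs_sub_left_of_mem_uIcc ht'
      rw [add_sub_cancel_left] at h1
      gcongr)
  rw [add_sub_cancel_left] at this
  rw [pow_succ, ← mul_assoc]
  exact this

end NodeQuadrature

theorem theorem6p1 (n : ℕ) (p q : ℝ) (hpq : p < q) (f : ℝ → ℝ)
    (hf : ContDiffOn ℝ ((2 * n + 1 : ℕ) : WithTop ℕ∞) f (Set.Icc p q)) :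
    ∃ C : ℝ, ∀ (u : Fin (n + 1) → ℝ) (x : ℝ), Function.Injective u →
      (∀ i, u i ∈ Set.Icc p q) → x ∈ Set.Icc p q → (∀ i, x ≠ u i) →
      ∃ ξ : ℕ → ℝ,
        (∀ k ≤ n, (∃ y ∈ insert x (Set.range u), y < ξ k) ∧
          (∃ z ∈ insert x (Set.range u), ξ k < z)) ∧
        ∀ h : ℝ, h ≠ 0 → x + h ∈ Set.Icc p q →
          |(∫ t in x..(x + h), f t) -
              ((∑ i, f (u i) * NodeQuadrature.L u x i *
                  ∑ k ∈ Finset.range (n + 1), NodeQuadrature.gam u x h k / (u i - x) ^ k) +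
                (∏ i, (x - u i)) *
                  ∑ k ∈ Finset.range (n + 1),
                    iteratedDerivWithin (n + 1 + k) f (Set.Icc p q) (ξ (n - k)) /
                      (Nat.factorial (n + 1 + k) : ℝ) * NodeQuadrature.gam u x h k)|
            ≤ C * |h| ^ (n + 2) := by
  obtain ⟨C, hC⟩ := NodeQuadrature.exists_taylor_integral_bound hpq
    (hf.of_le (m := ((n + 1 : ℕ) : WithTop ℕ∞)) (by exact_mod_cast (by omega : n + 1 ≤ 2 * n + 1)))
  refine ⟨C, fun u x hinj hu hxI hx => ?_⟩
  have hex : ∀ k, ∃ ξ : ℝ, k ≤ n → _ := fun k => by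
    by_cases hk : k ≤ n
    · obtain ⟨ξ, hξ⟩ := NodeQuadrature.exists_iteratedDerivWithin_eq (k := k) hpq hf (by omega)
        hinj hu hxI hx
      exact ⟨ξ, fun _ => hξ⟩
    · exact ⟨0, fun h => absurd h hk⟩
  choose η hη using hex
  -- `η k` belongs to the derivative of order `n + 1 + k`, whose point is called `ξ (n - k)` in the
  -- formula. The points are chosen before `h`.
  refine ⟨fun k => η (n - k), fun k _ => (hη (n - k) (Nat.sub_le _ _)).1, fun h _ hxh => ?_⟩
  set c := NodeQuadrature.taylorCoeff f (Set.Icc p q) x with hc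
  -- `b k` collects everything that multiplies `γ_k` in the formula.
  set b : ℕ → ℝ := fun k => ∑ i, f (u i) * NodeQuadrature.L u x i / (u i - x) ^ k +
    (∏ i, (x - u i)) * NodeQuadrature.taylorCoeff f (Set.Icc p q) (η k) (n + 1 + k) with hb
  have hbc : ∀ k ≤ n, b k = ∑ j ∈ range (k + 1), c j * NodeQuadrature.rho u x (k - j) := by
    intro k hk
    have hsum : ∑ i, NodeQuadrature.L u x i *
        (f (u i) - ∑ j ∈ range (k + 1), c j * (u i - x) ^ j) / (u i - x) ^ k =
        ∑ i, f (u i) * NodeQuadrature.L u x i / (u i - x) ^ k -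
          ∑ j ∈ range (k + 1), c j * NodeQuadrature.rho u x (k - j) := by
      simp only [NodeQuadrature.rho, mul_sum]
      rw [sum_comm, ← sum_sub_distrib]
      refine sum_congr rfl fun i _ => ?_
      have h1 : u i - x ≠ 0 := sub_ne_zero.2 (hx i).symm
      rw [mul_sub, sub_div, mul_comm (f (u i)), mul_sum, sum_div]
      congr 1
      refine sum_congr rfl fun j hj => ?_
      rw [← pow_sub_mul_pow (u i - x) (Nat.lt_succ_iff.1 (mem_range.1 hj))]
      field_simp
    have := (hη k hk).2
    rw [hsum] at this
    simp only [hb]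
    linarith
  have hmain := NodeQuadrature.sum_mul_gam hinj x h hbc
  convert hC x hxI h hxh using 3
  rw [hmain]
  simp only [hb, add_mul, sum_add_distrib, mul_sum, sum_mul]
  rw [sum_comm]
  congr 1
  · exact sum_congr rfl fun k _ => sum_congr rfl fun i _ => by ring
  · refine sum_congr rfl fun k hk => ?_
    rw [Nat.sub_sub_self (Nat.lt_succ_iff.1 (mem_range.1 hk)), NodeQuadrature.taylorCoeff]
    ring
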